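/- Consider $N\ge 1$ spins labelled by $\Lambda=\{1,\dots,N\}$, each with Hilbert space $\mathbb C^d$, and let $\|\cdot\|$ be the operator norm. Let $\rho_{\rm Prod}=\rho_1\otimes\cdots\otimes\rho_N$ be a product of one-spin density matrices. Let $k,\bar n\ge 1$ be integers, let $g>0$, and put $\lambda=2gk$. Let $$A=\frac1{\bar n}\sum_{j=1}^{\bar n}A_j^{\rm c},\qquad A_j^{\rm c}=\sum_{X\subset\Lambda}a_{j,X},$$ where each $A_j^{\rm c}$ is Hermitian and each $a_{j,X}$ is supported on the set of spins $X$, such that for every $j$: * ($k$-local) $a_{j,X}=0$ whenever $|X|>k$; * ($g$-extensive) $\sum_{X\ni i}\|a_{j,X}\|\le g$ for every spin $i$; * (non-overlapping) distinct sets $X,Y$ with $a_{j,X}\ne0\ne a_{j,Y}$ are disjoint; * (zero mean) $\operatorname{tr}(\rho_{\rm Prod}A_j^{\rm c})=0$. Let $N_j$ be the number of nonempty sets $X$ with $a_{j,X}\neq 0$. Write $M(A,\rho,\tau)=\log\operatorname{tr}(e^{\tau A}\rho)$, and let $\Pi^A_{\ge x}$, $\Pi^A_{\le -x}$ be the spectral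 projections of $A$ for eigenvalues $\ge x$, $\le -x$. There is a universal constant $C>0$ (independent of $N,d,k,g,\bar n,\rho_{\rm Prod}$ and the operators) such that, if $N_j\le N/k$ for all $j$, then $$M(A,\rho_{\rm Prod},\tau)\le\tilde C N\tau^2\quad\text{for all real }\tau\text{ with }|\tau|\le\frac1{4\lambda},\qquad \tilde C=\frac{2g^2C}{k}+\frac{3\lambda g}{2}\lceil\log_2\bar n\rceil,$$ and, for all $x\ge0$, both $\operatorname{tr}(\Pi^A_{\ge x}\rho_{\rm Prod})$ and $\operatorname{tr}(\Pi^A_{\le -x}\rho_{\rm Prod})$ are at most $$\max\left(e^{-x^2/(4\tilde CN)},\,e^{-x/(8\lambda)}\right).$$ Without the condition $N_j\le N/k$, the same bounds hold with $C$ replaced by $kC$ in $\tilde C$. -/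

import Mathlib

open scoped Matrix.Norms.L2Operator ComplexOrder

/-- Operators on the Hilbert space `(ℂ^d)^{⊗ N}` of `N` spins of dimension `d`, written as matrices
in the product basis, whose elements are the configurations `Fin N → Fin d`.
Their norm `‖·‖` is the operator norm (the largest singular value). -/
abbrev SpinOp (N d : ℕ) : Type := Matrix (Fin N → Fin d) (Fin N → Fin d) ℂ

/-- A quantum state (density matrix): positive semidefinite with trace one. -/
def IsDensityMatrix {m : Type*} [Fintype m] (ρ : Matrix m m ℂ) : Prop :=
  ρ.PosSemidef ∧ ρ.trace = 1

/-- The tensor product `r 0 ⊗ r 1 ⊗ ⋯ ⊗ r (N - 1)` of one-spin matrices. -/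
def tensorProd {N d : ℕ} (r : Fin N → Matrix (Fin d) (Fin d) ℂ) : SpinOp N d :=
  Matrix.of fun s t => ∏ i, r i (s i) (t i)

/-- `ρ = ρ₁ ⊗ ⋯ ⊗ ρ_N` with one-spin states `ρᵢ`. -/
def IsProductState {N d : ℕ} (ρ : SpinOp N d) : Prop :=
  ∃ r : Fin N → Matrix (Fin d) (Fin d) ℂ, (∀ i, IsDensityMatrix (r i)) ∧ ρ = tensorProd r

/-- The operator `b ⊗ 1` on all spins, for an operator `b` on the spins in `X`. -/
def extendByOne {N d : ℕ} (X : Finset (Fin N))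
    (b : Matrix (X → Fin d) (X → Fin d) ℂ) : SpinOp N d :=
  Matrix.of fun s t =>
    if ∀ i, i ∉ X → s i = t i then b (fun i => s i) (fun i => t i) else 0

/-- `a` is supported on the set of spins `X`. -/
def IsSupportedOn {N d : ℕ} (X : Finset (Fin N)) (a : SpinOp N d) : Prop :=
  ∃ b : Matrix (X → Fin d) (X → Fin d) ℂ, a = extendByOne X b

/-- `O = ∑_X o_X`, where each `o_X` is supported on the set of spins `X`
(`o_X = 0` if no term with support `X` is present). -/
def IsLocalSum {N d : ℕ} (o : Finset (Fin N) → SpinOp N d) (O : SpinOp N d) : Prop :=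
  (∀ X, IsSupportedOn X (o X)) ∧ O = ∑ X, o X

/-- Only supports with at most `k` spins occur (`k`-locality). -/
def IsKLocal {N d : ℕ} (k : ℕ) (o : Finset (Fin N) → SpinOp N d) : Prop :=
  ∀ X, k < X.card → o X = 0

/-- `∑_{X ∋ i} ‖o_X‖ ≤ g` for every spin `i` (`g`-extensiveness). -/
def IsGExtensive {N d : ℕ} (g : ℝ) (o : Finset (Fin N) → SpinOp N d) : Prop :=
  ∀ i : Fin N, ∑ X with i ∈ X, ‖o X‖ ≤ g

/-- The supports of distinct terms that are present are disjoint. -/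
def IsNonOverlapping {N d : ℕ} (o : Finset (Fin N) → SpinOp N d) : Prop :=
  ∀ X Y, X ≠ Y → o X ≠ 0 → o Y ≠ 0 → Disjoint X Y

open Classical in
/-- The number of terms that are present (a multiple of the identity, that is, a term with empty
support, is not counted). -/
noncomputable def numTerms {N d : ℕ} (o : Finset (Fin N) → SpinOp N d) : ℕ :=
  (Finset.univ.filter fun X : Finset (Fin N) => X.Nonempty ∧ o X ≠ 0).card

/-- `M(A, ρ, τ) = log tr (e^{τ A} ρ)`. For a Hermitian `A` and a state `ρ` the trace is a positive
real number. -/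
noncomputable def logMGF {N d : ℕ} (A ρ : SpinOp N d) (τ : ℝ) : ℝ :=
  Real.log ((NormedSpace.exp (τ • A) * ρ).trace).re

/-- The spectral projection of a Hermitian operator `A` onto the sum of its eigenspaces with
eigenvalue in `S`: the indicator function of `S` applied to `A`. -/
noncomputable def spectralProj {N d : ℕ} (A : SpinOp N d) (S : Set ℝ) : SpinOp N d :=
  cfc (S.indicator fun _ => (1 : ℝ)) A

/-- `2 g² C / k + (3 λ g / 2) ⌈log₂ n⌉` with `λ = 2 g k`. -/
noncomputable def chernoffConst (C g : ℝ) (k n : ℕ) : ℝ :=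
  2 * g ^ 2 * C / k + 3 * (2 * g * k) * g / 2 * (⌈Real.logb 2 n⌉ : ℤ)

/-- The Chernoff bounds for `A` in the state `ρ` with parameters `lam` and `K`:
the bound on the moment generating function and those on both tails of the distribution. -/
def ChernoffBounds {N d : ℕ} (A ρ : SpinOp N d) (lam K : ℝ) : Prop :=
  (∀ τ : ℝ, |τ| ≤ 1 / (4 * lam) → logMGF A ρ τ ≤ K * N * τ ^ 2) ∧
  (∀ x : ℝ, 0 ≤ x →
    ((spectralProj A (Set.Ici x) * ρ).trace).re ≤
      max (Real.exp (-(x ^ 2 / (4 * K * N)))) (Real.exp (-(x / (8 * lam))))) ∧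
  (∀ x : ℝ, 0 ≤ x →
    ((spectralProj A (Set.Iic (-x)) * ρ).trace).re ≤
      max (Real.exp (-(x ^ 2 / (4 * K * N)))) (Real.exp (-(x / (8 * lam)))))

/-! Everything follows from a bound `exp (K * N * τ ^ 2)` on the moment generating function; the
tails then come from Markov's inequality with the best admissible `τ`. A single non-overlapping
operator is easy: in a product state its generating function factorizes over the supports, and each
factor is at most a Gaussian because the terms can be centred (`stateExpect_exp_nonoverlapping_le`).
The operators in the average do not commute. They are averaged in pairs, along a binary tree of
depth `⌈log₂ n⌉`. One merge writes `e^{(A+B)/2} = e^{A/2} Ψ e^{B/2}` with `Ψ = e^{-A/2} e^{(A+B)/2}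
e^{-B/2}`, and Cauchy-Schwarz (`stateExpect_mul_mul_le`) bounds its expectation by `‖Ψ‖` times a
common bound for `e^A` and `e^B`. So each level of the tree costs a factor `‖Ψ‖`, which gives the
logarithm in the constant. The crux is that `‖Ψ‖` is at most the exponential of a multiple of `N τ²`
(`IsLocalExtensive.norm_exp_splitting_le`). A differential equation reduces this to nested
commutators, and locality bounds those of order `n` by `h N (2hk)^n n!`
(`IsLocalExtensive.nested_lie`), so the series converge for small `τ`. -/

open scoped Kronecker Nat

/-! ### Operators supported on a set of spins, and independence in product states. -/

section Support

variable {N d : ℕ}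

/-- Splitting a configuration into its restrictions to `X` and to the complement of `X`. -/
abbrev splitConfig (d : ℕ) (X : Finset (Fin N)) :
    (Fin N → Fin d) ≃ ({i // i ∈ X} → Fin d) × ({i // i ∉ X} → Fin d) :=
  Equiv.piEquivPiSubtypeProd (· ∈ X) fun _ => Fin d

theorem extendByOne_eq (X : Finset (Fin N)) (b : Matrix (X → Fin d) (X → Fin d) ℂ) :
    extendByOne X b = (b ⊗ₖ (1 : Matrix ({i // i ∉ X} → Fin d) ({i // i ∉ X} → Fin d) ℂ)).submatrix
      (splitConfig d X) (splitConfig d X) := by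
  ext s t
  simp only [extendByOne, Matrix.of_apply, Matrix.submatrix_apply, Matrix.kroneckerMap_apply,
    Matrix.one_apply, Equiv.piEquivPiSubtypeProd_apply, mul_ite, mul_one, mul_zero, funext_iff,
    Subtype.forall]

/-- `b ↦ b ⊗ 1` as a homomorphism of star algebras. -/
def extendHom (d : ℕ) (X : Finset (Fin N)) :
    Matrix (X → Fin d) (X → Fin d) ℂ →⋆ₐ[ℂ] SpinOp N d where
  toFun := extendByOne X
  map_one' := by simp [extendByOne_eq]
  map_mul' a b := by
    simp only [extendByOne_eq, Matrix.submatrix_mul_equiv, ← Matrix.mul_kronecker_mul, one_mul]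
  map_zero' := by simp [extendByOne_eq]
  map_add' a b := by
    simp [extendByOne_eq, Matrix.add_kronecker, Matrix.submatrix_add]
  commutes' c := by
    simp [extendByOne_eq, Algebra.algebraMap_eq_smul_one, Matrix.smul_kronecker,
      Matrix.submatrix_smul]
  map_star' a := by
    simp [extendByOne_eq, Matrix.star_eq_conjTranspose, Matrix.conjTranspose_kronecker,
      Matrix.conjTranspose_submatrix]

theorem isSupportedOn_iff_mem_range {X : Finset (Fin N)} {a : SpinOp N d} :
    IsSupportedOn X a ↔ a ∈ (extendHom d X).range :=
  ⟨fun ⟨b, h⟩ => ⟨b, h.symm⟩, fun ⟨b, h⟩ => ⟨b, h.symm⟩⟩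

namespace IsSupportedOn

variable {X Y : Finset (Fin N)} {a b : SpinOp N d}

theorem zero (X : Finset (Fin N)) : IsSupportedOn X (0 : SpinOp N d) :=
  isSupportedOn_iff_mem_range.2 (zero_mem _)

theorem smul_one (X : Finset (Fin N)) (c : ℂ) : IsSupportedOn X (c • 1 : SpinOp N d) :=
  isSupportedOn_iff_mem_range.2 ((extendHom d X).range.smul_mem (one_mem _) c)

theorem add (ha : IsSupportedOn X a) (hb : IsSupportedOn X b) : IsSupportedOn X (a + b) :=
  isSupportedOn_iff_mem_range.2
    (add_mem (isSupportedOn_iff_mem_range.1 ha) (isSupportedOn_iff_mem_range.1 hb))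

theorem sub (ha : IsSupportedOn X a) (hb : IsSupportedOn X b) : IsSupportedOn X (a - b) :=
  isSupportedOn_iff_mem_range.2
    (sub_mem (isSupportedOn_iff_mem_range.1 ha) (isSupportedOn_iff_mem_range.1 hb))

theorem mul (ha : IsSupportedOn X a) (hb : IsSupportedOn X b) : IsSupportedOn X (a * b) :=
  isSupportedOn_iff_mem_range.2
    (mul_mem (isSupportedOn_iff_mem_range.1 ha) (isSupportedOn_iff_mem_range.1 hb))

theorem smul (c : ℂ) (ha : IsSupportedOn X a) : IsSupportedOn X (c • a) :=
  isSupportedOn_iff_mem_range.2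
    ((extendHom d X).range.smul_mem (isSupportedOn_iff_mem_range.1 ha) c)

theorem real_smul (c : ℝ) (ha : IsSupportedOn X a) : IsSupportedOn X (c • a) := by
  simpa using ha.smul (c : ℂ)

theorem star (ha : IsSupportedOn X a) : IsSupportedOn X (star a) := by
  obtain ⟨b, rfl⟩ := ha
  exact ⟨Star.star b, (map_star (extendHom d X) b).symm⟩

theorem sum {ι : Type*} {s : Finset ι} {f : ι → SpinOp N d}
    (h : ∀ i ∈ s, IsSupportedOn X (f i)) : IsSupportedOn X (∑ i ∈ s, f i) :=
  isSupportedOn_iff_mem_range.2 (sum_mem fun i hi => isSupportedOn_iff_mem_range.1 (h i hi))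

theorem exp (ha : IsSupportedOn X a) : IsSupportedOn X (NormedSpace.exp a) := by
  obtain ⟨b, rfl⟩ := ha
  let _ : NormedAlgebra ℚ (Matrix (X → Fin d) (X → Fin d) ℂ) := .restrictScalars ℚ ℂ _
  exact ⟨NormedSpace.exp b, (NormedSpace.map_exp (extendHom d X)
    (extendHom d X).toLinearMap.continuous_of_finiteDimensional b).symm⟩

theorem mono (hXY : X ⊆ Y) (ha : IsSupportedOn X a) : IsSupportedOn Y a := by
  obtain ⟨b, rfl⟩ := ha
  refine ⟨Matrix.of fun s t => if ∀ i : Y, i.1 ∉ X → s i = t i then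
    b (fun i => s ⟨i, hXY i.2⟩) (fun i => t ⟨i, hXY i.2⟩) else 0, ?_⟩
  ext s t
  simp only [extendByOne, Matrix.of_apply, Subtype.forall]
  rw [← ite_and]
  refine if_congr ⟨fun h => ⟨fun i hi => h i fun hX => hi (hXY hX), fun i _ hi => h i hi⟩,
    fun h i hi => ?_⟩ rfl rfl
  by_cases hY : i ∈ Y
  · exact h.2 i hY hi
  · exact h.1 i hY

/-- Operators with disjoint supports are put into the two factors of one and the same tensor
splitting; commutation and independence can then be read off from Kronecker products. -/
theorem exists_one_kronecker (hXY : Disjoint X Y) (ha : IsSupportedOn Y a) :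
    ∃ b, a = ((1 : Matrix ({i // i ∈ X} → Fin d) ({i // i ∈ X} → Fin d) ℂ) ⊗ₖ b).submatrix
      (splitConfig d X) (splitConfig d X) := by
  obtain ⟨b, rfl⟩ := ha
  have hY : ∀ i, i ∈ Y → i ∉ X := fun i hi hX => Finset.disjoint_left.1 hXY hX hi
  refine ⟨Matrix.of fun s t => if ∀ i : {i // i ∉ X}, i.1 ∉ Y → s i = t i then
    b (fun i => s ⟨i, hY i i.2⟩) (fun i => t ⟨i, hY i i.2⟩) else 0, ?_⟩
  ext s t
  simp only [extendByOne, Matrix.of_apply, Subtype.forall, Matrix.submatrix_apply,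
    Matrix.kroneckerMap_apply, Matrix.one_apply, Equiv.piEquivPiSubtypeProd_apply, funext_iff,
    ite_mul, one_mul, zero_mul]
  rw [← ite_and]
  refine if_congr ⟨fun h => ⟨fun i hi => h i fun hy => hY i hy hi, fun i _ hi => h i hi⟩,
    fun h i hi => ?_⟩ rfl rfl
  by_cases hX : i ∈ X
  · exact h.1 i hX
  · exact h.2 i hX hi

theorem commute (hXY : Disjoint X Y) (ha : IsSupportedOn X a) (hb : IsSupportedOn Y b) :
    Commute a b := by
  obtain ⟨b, rfl⟩ := hb.exists_one_kronecker hXY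
  obtain ⟨a, rfl⟩ := ha
  simp only [Commute, SemiconjBy, extendByOne_eq, Matrix.submatrix_mul_equiv,
    ← Matrix.mul_kronecker_mul, one_mul, mul_one]

end IsSupportedOn

theorem tensorProd_eq_kronecker (r : Fin N → Matrix (Fin d) (Fin d) ℂ) (X : Finset (Fin N)) :
    ∃ p q, tensorProd r = (p ⊗ₖ q).submatrix (splitConfig d X) (splitConfig d X) := by
  refine ⟨Matrix.of fun s t => ∏ i : {i // i ∈ X}, r i (s i) (t i),
    Matrix.of fun s t => ∏ i : {i // i ∉ X}, r i (s i) (t i), ?_⟩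
  ext s t
  simp only [tensorProd, Matrix.of_apply, Matrix.submatrix_apply, Matrix.kroneckerMap_apply,
    Equiv.piEquivPiSubtypeProd_apply]
  convert! (Fintype.prod_subtype_mul_prod_subtype (· ∈ X) fun i => r i (s i) (t i)).symm

theorem trace_submatrix_equiv {m n : Type*} [Fintype m] [Fintype n] (e : m ≃ n)
    (M : Matrix n n ℂ) : (M.submatrix e e).trace = M.trace :=
  Fintype.sum_equiv e _ _ fun _ => rfl

theorem trace_tensorProd (r : Fin N → Matrix (Fin d) (Fin d) ℂ) :
    (tensorProd r).trace = ∏ i, (r i).trace := by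
  simp only [Matrix.trace, tensorProd, Matrix.diag_apply, Matrix.of_apply]
  exact (Fintype.prod_sum fun i j => r i j j).symm

/-- In a product state, observables with disjoint supports are independent. -/
theorem trace_tensorProd_mul_mul {r : Fin N → Matrix (Fin d) (Fin d) ℂ}
    (hr : (tensorProd r).trace = 1) {X Y : Finset (Fin N)} (hXY : Disjoint X Y) {a b : SpinOp N d}
    (ha : IsSupportedOn X a) (hb : IsSupportedOn Y b) :
    (tensorProd r * (a * b)).trace = (tensorProd r * a).trace * (tensorProd r * b).trace := by
  obtain ⟨b, rfl⟩ := hb.exists_one_kronecker hXY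
  obtain ⟨a, rfl⟩ := ha
  obtain ⟨p, q, h⟩ := tensorProd_eq_kronecker r X
  rw [h] at hr ⊢
  simp only [extendByOne_eq, Matrix.submatrix_mul_equiv, ← Matrix.mul_kronecker_mul, one_mul,
    mul_one, trace_submatrix_equiv, Matrix.trace_kronecker] at hr ⊢
  -- The right-hand side has the extra factor `tr p * tr q`, which `hr` says is 1.
  linear_combination (-(p * a).trace * (q * b).trace) * hr

end Support

/-! ### Exponentials and nested commutators in a Banach algebra. -/

theorem HasSum.of_eq {M : Type*} [AddCommMonoid M] [TopologicalSpace M] {f g : ℕ → M} {a : M}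
    (h : ∀ n, f n = g n) (hg : HasSum g a) : HasSum f a :=
  (funext h : f = g) ▸ hg

theorem iterate_smul_lie {𝔸 : Type*} [NormedRing 𝔸] [NormedAlgebra ℝ 𝔸]
    (s : ℝ) (a b : 𝔸) (n : ℕ) :
    (fun y => ⁅s • a, y⁆)^[n] b = s ^ n • (fun y => ⁅a, y⁆)^[n] b := by
  induction n with
  | zero => simp
  | succ n ih =>
    rw [Function.iterate_succ_apply', ih, Function.iterate_succ_apply', pow_succ']
    simp only [Ring.lie_def, smul_mul_assoc, mul_smul_comm, smul_smul, smul_sub]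
    rw [mul_comm s]

section BanachAlgebra

variable {𝔸 : Type*} [NormedRing 𝔸] [NormedAlgebra ℝ 𝔸] [CompleteSpace 𝔸]

theorem exp_mul_exp_neg_self (a : 𝔸) : NormedSpace.exp a * NormedSpace.exp (-a) = 1 := by
  let _ : NormedAlgebra ℚ 𝔸 := .restrictScalars ℚ ℝ 𝔸
  rw [← NormedSpace.exp_add_of_commute (Commute.refl a).neg_right, add_neg_cancel,
    NormedSpace.exp_zero]

theorem exp_neg_mul_exp_self (a : 𝔸) : NormedSpace.exp (-a) * NormedSpace.exp a = 1 := by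
  simpa using exp_mul_exp_neg_self (-a)

theorem exp_mul_left_apply (a b : 𝔸) :
    NormedSpace.exp (ContinuousLinearMap.mul ℝ 𝔸 a) b = NormedSpace.exp a * b := by
  have h := (NormedSpace.exp_series_hasSum_exp' (𝕂 := ℝ)
    (ContinuousLinearMap.mul ℝ 𝔸 a)).mapL (ContinuousLinearMap.apply ℝ 𝔸 b)
  refine h.unique ?_
  refine HasSum.of_eq (fun n => ?_)
    ((NormedSpace.exp_series_hasSum_exp' (𝕂 := ℝ) a).mul_right b)
  have : (ContinuousLinearMap.mul ℝ 𝔸 a ^ n) b = a ^ n * b := by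
    induction n with
    | zero => simp
    | succ n ih => simp [pow_succ', ih, mul_assoc]
  simp [this]

theorem exp_mul_right_apply (a b : 𝔸) :
    NormedSpace.exp ((ContinuousLinearMap.mul ℝ 𝔸).flip a) b = b * NormedSpace.exp a := by
  have h := (NormedSpace.exp_series_hasSum_exp' (𝕂 := ℝ)
    ((ContinuousLinearMap.mul ℝ 𝔸).flip a)).mapL (ContinuousLinearMap.apply ℝ 𝔸 b)
  refine h.unique ?_
  refine HasSum.of_eq (fun n => ?_)
    ((NormedSpace.exp_series_hasSum_exp' (𝕂 := ℝ) a).mul_left b)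
  have : ((ContinuousLinearMap.mul ℝ 𝔸).flip a ^ n) b = b * a ^ n := by
    induction n with
    | zero => simp
    | succ n ih => rw [pow_succ', mul_apply_eq_comp, ih]; simp [pow_succ, mul_assoc]
  simp [this]

/-- The commutator with `a` is left multiplication by `a` plus right multiplication by `-a`. These
commute, so its exponential is the product of their exponentials, which is conjugation by `exp a`.
-/
theorem hasSum_exp_conj (a b : 𝔸) :
    HasSum (fun n : ℕ => (n ! : ℝ)⁻¹ • (fun y => ⁅a, y⁆)^[n] b)
      (NormedSpace.exp a * b * NormedSpace.exp (-a)) := by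
  let L := ContinuousLinearMap.mul ℝ 𝔸
  let _ : NormedAlgebra ℚ (𝔸 →L[ℝ] 𝔸) := .restrictScalars ℚ ℝ _
  have hc : Commute (L a) (L.flip (-a)) := by
    ext y
    simp [L, mul_assoc]
  have h := (NormedSpace.exp_series_hasSum_exp' (𝕂 := ℝ)
    (L a + L.flip (-a))).mapL (ContinuousLinearMap.apply ℝ 𝔸 b)
  rw [NormedSpace.exp_add_of_commute hc] at h
  simp only [ContinuousLinearMap.apply_apply, mul_apply_eq_comp] at h
  rw [show NormedSpace.exp (L a) (NormedSpace.exp (L.flip (-a)) b) =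
    NormedSpace.exp a * b * NormedSpace.exp (-a) by
      rw [exp_mul_left_apply, exp_mul_right_apply, mul_assoc]] at h
  refine HasSum.of_eq (fun n => ?_) h
  have : ((L a + L.flip (-a)) ^ n) b = (fun y => ⁅a, y⁆)^[n] b := by
    induction n with
    | zero => simp
    | succ n ih =>
      rw [pow_succ', mul_apply_eq_comp, ih, Function.iterate_succ_apply']
      simp [L, Ring.lie_def, sub_eq_add_neg]
  rw [smul_apply, this]

/-- Dividing the factorial growth by `l!` leaves the series of `(l + m).choose m * (μ * u) ^ l`,
whose sum is `1 / (1 - μ * u) ^ (m + 1)`. -/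
theorem norm_exp_conj_le {a y : 𝔸} {K μ u : ℝ} {m : ℕ} (hu : 0 ≤ u) (hμ : 0 ≤ μ) (hμu : μ * u < 1)
    (h : ∀ l, ‖(fun y => ⁅a, y⁆)^[l] y‖ ≤ K * μ ^ (l + m) * (l + m)!) :
    ‖NormedSpace.exp (u • a) * y * NormedSpace.exp (-(u • a))‖ ≤
      K * μ ^ m * m ! / (1 - μ * u) ^ (m + 1) := by
  have h0 : 0 ≤ μ * u := mul_nonneg hμ hu
  have hs := (hasSum_choose_mul_geometric_of_norm_lt_one m (r := μ * u)
    (by rwa [Real.norm_of_nonneg h0])).mul_left (K * μ ^ m * m !)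
  rw [mul_one_div] at hs
  refine (hasSum_exp_conj (u • a) y).norm_le_of_bounded hs fun l => ?_
  rw [iterate_smul_lie, smul_smul, norm_smul, Real.norm_of_nonneg (by positivity)]
  refine (mul_le_mul_of_nonneg_left (h l) (by positivity)).trans_eq ?_
  have hch : ((l + m).choose m : ℝ) * l ! * m ! = (l + m)! := by
    have := Nat.add_choose_mul_factorial_mul_factorial l m
    exact_mod_cast this
  rw [← hch, mul_pow, pow_add]
  field_simp

theorem norm_exp_conj_exp_conj_sub_le {a b y : 𝔸} {K μ s : ℝ} (hs0 : 0 ≤ s) (hs1 : s ≤ 1)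
    (hK : 0 ≤ K) (hμ : 0 ≤ μ) (hμ1 : μ < 1)
    (h : ∀ l m, ‖(fun y => ⁅b, y⁆)^[l] ((fun y => ⁅a, y⁆)^[m + 1] y)‖ ≤
      K * μ ^ (l + (m + 1)) * (l + (m + 1))!) :
    ‖NormedSpace.exp ((1 - s) • b) *
        (NormedSpace.exp (-(s • a)) * y * NormedSpace.exp (s • a) - y) *
        NormedSpace.exp (-((1 - s) • b))‖ ≤ K * (μ / (1 - μ)) := by
  have hu : 0 ≤ 1 - s := by linarith
  have hq : 0 < 1 - μ * (1 - s) := by nlinarith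
  have h1 := hasSum_exp_conj ((-s) • a) y
  -- Removing the zeroth term of the series accounts for the subtraction of `y`; at least one
  -- commutator with `a` remains.
  rw [← hasSum_nat_add_iff' 1] at h1
  simp only [Finset.range_one, Finset.sum_singleton, Nat.factorial_zero, Nat.cast_one, inv_one,
    Function.iterate_zero, id_eq, one_smul, neg_smul, neg_neg] at h1
  have h2 := (h1.mul_left (NormedSpace.exp ((1 - s) • b))).mul_right
    (NormedSpace.exp (-((1 - s) • b)))
  set r := μ * s / (1 - μ * (1 - s)) with hr
  have hr0 : 0 ≤ r := by positivity
  have hr1 : r < 1 := by rw [hr, div_lt_one hq]; nlinarith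
  have h3 := (hasSum_geometric_of_lt_one hr0 hr1).mul_left (K * r / (1 - μ * (1 - s)))
  refine (h2.norm_le_of_bounded h3 fun m => ?_).trans ?_
  · rw [← neg_smul, iterate_smul_lie, smul_smul, mul_smul_comm, smul_mul_assoc, norm_smul]
    have h4 := norm_exp_conj_le (m := m + 1) hu hμ (by linarith)
      (fun l => h l m)
    refine (mul_le_mul_of_nonneg_left h4 (norm_nonneg _)).trans_eq ?_
    rw [norm_mul, norm_pow, norm_neg, Real.norm_of_nonneg hs0, Real.norm_of_nonneg (by positivity),
      hr, div_pow, mul_pow, pow_succ (1 - μ * (1 - s)) (m + 1)]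
    field_simp
    ring
  · have h5 : 1 - r = (1 - μ) / (1 - μ * (1 - s)) := by rw [hr]; field_simp; ring
    have h6 : 0 < 1 - μ := by linarith
    have h7 : K * r / (1 - μ * (1 - s)) * (1 - r)⁻¹ =
      K * (μ / (1 - μ)) * (s / (1 - μ * (1 - s))) := by rw [h5, hr]; field_simp
    rw [h7]
    -- The remaining inequality `s ≤ 1 - μ * (1 - s)` is `0 ≤ (1 - μ) * (1 - s)`.
    refine mul_le_of_le_one_right (by positivity) ?_
    rw [div_le_one hq]
    nlinarith

/-- Two-sided splitting of the exponential of a sum, with an error controlled by nested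
commutators. -/
theorem norm_exp_neg_mul_exp_add_mul_exp_neg_le (h1 : ‖(1 : 𝔸)‖ ≤ 1) {a b : 𝔸} {K μ : ℝ}
    (hK : 0 ≤ K) (hμ : 0 ≤ μ) (hμ1 : μ < 1)
    (h : ∀ l m, ‖(fun y => ⁅b, y⁆)^[l] ((fun y => ⁅a, y⁆)^[m + 1] b)‖ ≤
      K * μ ^ (l + (m + 1)) * (l + (m + 1))!) :
    ‖NormedSpace.exp (-a) * NormedSpace.exp (a + b) * NormedSpace.exp (-b)‖ ≤
      Real.exp (K * (μ / (1 - μ))) := by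
  -- `P` joins `P 0 = 1` to the product to be bounded, `P 1`. It solves `P' = G P`, where `G` only
  -- sees the failure of `a` and `b` to commute, so Grönwall's inequality applies.
  let P : ℝ → 𝔸 := fun s => NormedSpace.exp ((1 - s) • b) * NormedSpace.exp (s • -a) *
    NormedSpace.exp (s • (a + b)) * NormedSpace.exp (-b)
  let G : ℝ → 𝔸 := fun s => NormedSpace.exp ((1 - s) • b) *
        (NormedSpace.exp (-(s • a)) * b * NormedSpace.exp (s • a) - b) *
        NormedSpace.exp (-((1 - s) • b))
  have hd : ∀ s, HasDerivAt P (G s * P s) s := by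
    intro s
    have d1 : HasDerivAt (fun s : ℝ => NormedSpace.exp ((1 - s) • b))
        (-(NormedSpace.exp ((1 - s) • b) * b)) s := by
      simpa [Function.comp_def] using (hasDerivAt_exp_smul_const b (1 - s)).scomp s
        ((hasDerivAt_id s).const_sub 1)
    have d2 := hasDerivAt_exp_smul_const (-a) s
    have d3 := hasDerivAt_exp_smul_const' (a + b) s
    refine HasDerivAt.congr_deriv (f := P)
      (((d1.mul d2).mul d3).mul_const (NormedSpace.exp (-b))) (Eq.symm ?_)
    simp only [P, G, Pi.mul_apply]
    have e1 := exp_neg_mul_exp_self ((1 - s) • b)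
    have e2 := exp_mul_exp_neg_self (s • a)
    rw [smul_neg]
    generalize NormedSpace.exp (-((1 - s) • b)) = x' at *
    generalize NormedSpace.exp (((1 - s) • b)) = x at *
    generalize NormedSpace.exp (-(s • a)) = z' at *
    generalize NormedSpace.exp ((s • a)) = z at *
    generalize NormedSpace.exp (s • (a + b)) = w at *
    generalize NormedSpace.exp (-b) = v at *
    calc x * (z' * b * z - b) * x' * (x * z' * w * v)
        = x * (z' * b * z - b) * (x' * x) * z' * w * v := by noncomm_ring
      _ = x * z' * b * (z * z') * w * v - x * b * z' * w * v := by rw [e1]; noncomm_ring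
      _ = _ := by rw [e2]; noncomm_ring
  have hG := norm_le_gronwallBound_of_norm_deriv_right_le (f := P) (f' := fun s => G s * P s)
    (δ := 1) (K := K * (μ / (1 - μ))) (ε := 0) (a := 0) (b := 1)
    (fun s _ => (hd s).continuousAt.continuousWithinAt) (fun s _ => (hd s).hasDerivWithinAt)
    (by simpa [P, exp_mul_exp_neg_self] using h1)
    (fun s hs => by
      rw [add_zero]
      exact (norm_mul_le _ _).trans (mul_le_mul_of_nonneg_right
        (norm_exp_conj_exp_conj_sub_le hs.1 hs.2.le hK hμ hμ1 h) (norm_nonneg _)))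
    1 (by simp)
  simpa [P, gronwallBound_ε0] using hG

end BanachAlgebra

/-! ### Commutator bounds for local and extensive operators. -/

section Locality

variable {N d : ℕ}

/-- `O` is a `k`-local and `h`-extensive operator, up to a multiple of the identity. -/
def IsLocalExtensive (k : ℕ) (h : ℝ) (O : SpinOp N d) : Prop :=
  ∃ (c : ℂ) (o : Finset (Fin N) → SpinOp N d), (∀ X, IsSupportedOn X (o X)) ∧ o ∅ = 0 ∧
    IsKLocal k o ∧ IsGExtensive h o ∧ O = c • 1 + ∑ X, o X

/-- `O` is a sum of operators supported on at most `m` spins, whose norms add up to at most `T`. -/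
def IsLocalBounded (m : ℕ) (T : ℝ) (O : SpinOp N d) : Prop :=
  ∃ o : Finset (Fin N) → SpinOp N d, (∀ X, IsSupportedOn X (o X)) ∧ IsKLocal m o ∧
    ∑ X, ‖o X‖ ≤ T ∧ O = ∑ X, o X

theorem IsLocalBounded.norm_le {m : ℕ} {T : ℝ} {O : SpinOp N d} (h : IsLocalBounded m T O) :
    ‖O‖ ≤ T := by
  obtain ⟨o, -, -, hT, rfl⟩ := h
  exact (norm_sum_le _ _).trans hT

theorem IsGExtensive.sum_not_disjoint_le {h : ℝ} {o : Finset (Fin N) → SpinOp N d}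
    (ho : IsGExtensive h o) (Y : Finset (Fin N)) :
    ∑ X with ¬Disjoint X Y, ‖o X‖ ≤ Y.card * h := by
  calc ∑ X with ¬Disjoint X Y, ‖o X‖
      ≤ ∑ X, ∑ i ∈ Y, if i ∈ X then ‖o X‖ else 0 := by
        rw [Finset.sum_filter]
        refine Finset.sum_le_sum fun X _ => ?_
        have h0 : ∀ i, 0 ≤ if i ∈ X then ‖o X‖ else 0 := fun i => by split_ifs <;> simp
        by_cases hX : Disjoint X Y
        · simpa [hX] using Finset.sum_nonneg fun i _ => h0 i
        · obtain ⟨i, hiX, hiY⟩ := Finset.not_disjoint_iff.1 hX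
          refine le_trans ?_ (Finset.single_le_sum (fun j _ => h0 j) hiY)
          simp [hX, hiX]
    _ = ∑ i ∈ Y, ∑ X with i ∈ X, ‖o X‖ := by
        rw [Finset.sum_comm]
        simp only [Finset.sum_filter]
    _ ≤ Y.card * h := by
        rw [← nsmul_eq_mul]
        exact Finset.sum_le_card_nsmul _ _ _ fun i _ => ho i

theorem IsGExtensive.sum_nonempty_le {h : ℝ} {o : Finset (Fin N) → SpinOp N d}
    (ho : IsGExtensive h o) : ∑ X : Finset (Fin N) with X.Nonempty, ‖o X‖ ≤ h * N := by
  refine le_trans (le_of_eq (Finset.sum_congr ?_ fun _ _ => rfl))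
    ((ho.sum_not_disjoint_le Finset.univ).trans_eq ?_)
  · ext X
    rw [Finset.mem_filter, Finset.mem_filter, Finset.not_disjoint_iff]
    simp [Finset.Nonempty]
  · simp [mul_comm]

theorem norm_lie_le {𝔸 : Type*} [NormedRing 𝔸] (a b : 𝔸) : ‖⁅a, b⁆‖ ≤ 2 * ‖a‖ * ‖b‖ := by
  rw [Ring.lie_def]
  refine (norm_sub_le _ _).trans ?_
  linarith [norm_mul_le a b, norm_mul_le b a]

/-- Only pairs of intersecting supports contribute. A set of at most `m` spins meets terms of `A` of
total norm at most `m * h`, and a commutator costs a factor 2. -/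
theorem IsLocalExtensive.lie_localBounded {k m : ℕ} {h T : ℝ} (hh : 0 ≤ h) {A O : SpinOp N d}
    (hA : IsLocalExtensive k h A) (hO : IsLocalBounded m T O) :
    IsLocalBounded (m + k) (2 * h * m * T) ⁅A, O⁆ := by
  obtain ⟨c, a, ha, -, hak, hag, rfl⟩ := hA
  obtain ⟨o, ho, hom, hoT, rfl⟩ := hO
  let s : Finset (Finset (Fin N) × Finset (Fin N)) :=
    Finset.univ.filter fun p => ¬Disjoint p.1 p.2
  let f : Finset (Fin N) × Finset (Fin N) → SpinOp N d := fun p => ⁅a p.1, o p.2⁆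
  refine ⟨fun Z => ∑ p ∈ s with p.1 ∪ p.2 = Z, f p, fun Z => ?_, fun Z hZ => ?_, ?_, ?_⟩
  · refine IsSupportedOn.sum fun p hp => ?_
    have hpZ := (Finset.mem_filter.1 hp).2
    have h1 : IsSupportedOn Z (a p.1) := (ha p.1).mono (hpZ ▸ Finset.subset_union_left)
    have h2 : IsSupportedOn Z (o p.2) := (ho p.2).mono (hpZ ▸ Finset.subset_union_right)
    simp only [f, Ring.lie_def]
    exact (h1.mul h2).sub (h2.mul h1)
  · refine Finset.sum_eq_zero fun p hp => ?_
    have hpZ := (Finset.mem_filter.1 hp).2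
    have hc := Finset.card_union_le p.1 p.2
    rw [hpZ] at hc
    rcases lt_or_ge k p.1.card with h1 | h1
    · simp [f, hak _ h1, Ring.lie_def]
    · simp [f, hom p.2 (by omega), Ring.lie_def]
  · calc ∑ Z, ‖∑ p ∈ s with p.1 ∪ p.2 = Z, f p‖
        ≤ ∑ Z, ∑ p ∈ s with p.1 ∪ p.2 = Z, ‖f p‖ := Finset.sum_le_sum fun Z _ => norm_sum_le _ _
      _ = ∑ p ∈ s, ‖f p‖ := Finset.sum_fiberwise s (fun p => p.1 ∪ p.2) fun p => ‖f p‖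
      _ ≤ ∑ p ∈ s, 2 * ‖a p.1‖ * ‖o p.2‖ := Finset.sum_le_sum fun p _ => norm_lie_le _ _
      _ = ∑ Y, 2 * ‖o Y‖ * ∑ X with ¬Disjoint X Y, ‖a X‖ := by
        rw [Finset.sum_filter, Fintype.sum_prod_type_right]
        refine Finset.sum_congr rfl fun Y _ => ?_
        rw [Finset.mul_sum, Finset.sum_filter]
        exact Finset.sum_congr rfl fun X _ => by split_ifs <;> ring
      _ ≤ ∑ Y, 2 * ‖o Y‖ * (m * h) := by
        refine Finset.sum_le_sum fun Y _ => ?_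
        rcases lt_or_ge m Y.card with h1 | h1
        · simp [hom _ h1]
        · refine mul_le_mul_of_nonneg_left ((hag.sum_not_disjoint_le Y).trans ?_) (by positivity)
          exact mul_le_mul_of_nonneg_right (by exact_mod_cast h1) hh
      _ = 2 * h * m * ∑ Y, ‖o Y‖ := by
        rw [Finset.mul_sum]
        exact Finset.sum_congr rfl fun Y _ => by ring
      _ ≤ 2 * h * m * T := mul_le_mul_of_nonneg_left hoT (by positivity)
  · rw [Finset.sum_fiberwise s (fun p => p.1 ∪ p.2) f, Finset.sum_filter, Fintype.sum_prod_type,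
      Ring.lie_def, add_mul, mul_add, smul_mul_assoc, mul_smul_comm, one_mul, mul_one,
      add_sub_add_left_eq_sub, Finset.sum_mul_sum, Finset.sum_mul_sum]
    rw [Finset.sum_comm (f := fun Y X => o Y * a X), ← Finset.sum_sub_distrib]
    refine Finset.sum_congr rfl fun X _ => ?_
    rw [← Finset.sum_sub_distrib]
    refine Finset.sum_congr rfl fun Y _ => ?_
    split_ifs with hXY <;> dsimp only at hXY
    · rw [((ha X).commute hXY (ho Y)).eq, sub_self]
    · rfl

theorem IsLocalExtensive.exists_localBounded {k : ℕ} {h : ℝ} {O : SpinOp N d}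
    (hO : IsLocalExtensive k h O) :
    ∃ (c : ℂ) (O' : SpinOp N d), IsLocalBounded k (h * N) O' ∧ O = c • 1 + O' := by
  obtain ⟨c, o, ho, h0, hk, hg, rfl⟩ := hO
  refine ⟨c, _, ⟨o, ho, hk, ?_, rfl⟩, rfl⟩
  refine le_trans (le_of_eq (Eq.symm ?_)) hg.sum_nonempty_le
  rw [Finset.sum_filter]
  refine Finset.sum_congr rfl fun X _ => ?_
  split_ifs with hX
  · rfl
  · rw [Finset.not_nonempty_iff_eq_empty.1 hX, h0, norm_zero]

/-- After `n` commutators the supports have at most `k * (n + 1)` spins, so the next one costs `2 *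
h * k * (n + 1)`; the product of these costs is the factorial. -/
theorem IsLocalExtensive.nested_lie {k : ℕ} {h : ℝ} (hh : 0 ≤ h) {A B : SpinOp N d}
    (hA : IsLocalExtensive k h A) (hB : IsLocalExtensive k h B) (l m : ℕ) :
    ‖(fun y => ⁅B, y⁆)^[l] ((fun y => ⁅A, y⁆)^[m + 1] B)‖ ≤
      h * N * (2 * h * k) ^ (l + (m + 1)) * (l + (m + 1))! := by
  have step : ∀ {C O : SpinOp N d} {n : ℕ}, IsLocalExtensive k h C →
      IsLocalBounded (k * (n + 1)) (h * N * (2 * h * k) ^ n * n !) O →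
      IsLocalBounded (k * (n + 1 + 1)) (h * N * (2 * h * k) ^ (n + 1) * (n + 1)!) ⁅C, O⁆ := by
    intro C O n hC hO
    convert hC.lie_localBounded hh hO using 1
    · ring
    · rw [Nat.factorial_succ]
      push_cast
      ring
  have hA' : IsLocalBounded (k * (m + 1 + 1)) (h * N * (2 * h * k) ^ (m + 1) * (m + 1)!)
      ((fun y => ⁅A, y⁆)^[m + 1] B) := by
    induction m with
    | zero =>
      -- The scalar part of `B` has no norm bound, but the first commutator removes it.
      obtain ⟨c, B', hB', rfl⟩ := hB.exists_localBounded
      have : ⁅A, c • (1 : SpinOp N d) + B'⁆ = ⁅A, B'⁆ := by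
        simp [Ring.lie_def, mul_add, add_mul]
      simp only [zero_add, Function.iterate_one, this]
      exact step (n := 0) hA (by simpa using hB')
    | succ m ih =>
      rw [Function.iterate_succ_apply']
      exact step hA ih
  have hB' : IsLocalBounded (k * (l + (m + 1) + 1))
      (h * N * (2 * h * k) ^ (l + (m + 1)) * (l + (m + 1))!)
      ((fun y => ⁅B, y⁆)^[l] ((fun y => ⁅A, y⁆)^[m + 1] B)) := by
    induction l with
    | zero => simpa using hA'
    | succ l ih =>
      rw [Function.iterate_succ_apply', show l + 1 + (m + 1) = l + (m + 1) + 1 by ring]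
      exact step hB ih
  exact hB'.norm_le

theorem norm_one_matrix_le {m : Type*} [Fintype m] [DecidableEq m] :
    ‖(1 : Matrix m m ℂ)‖ ≤ 1 := by
  rcases subsingleton_or_nontrivial (Matrix m m ℂ) with _ | _
  · rw [Subsingleton.elim (1 : Matrix m m ℂ) 0, norm_zero]
    exact zero_le_one
  · exact CStarRing.norm_one.le

theorem IsLocalExtensive.norm_exp_splitting_le {k : ℕ} {h : ℝ} (hh : 0 ≤ h)
    (hk : 2 * h * k ≤ 1 / 4) {A B : SpinOp N d}
    (hA : IsLocalExtensive k h A) (hB : IsLocalExtensive k h B) :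
    ‖NormedSpace.exp (-A) * NormedSpace.exp (A + B) * NormedSpace.exp (-B)‖ ≤
      Real.exp (4 / 3 * (h * N * (2 * h * k))) := by
  refine (norm_exp_neg_mul_exp_add_mul_exp_neg_le norm_one_matrix_le (K := h * N) (μ := 2 * h * k) (by positivity)
    (by positivity) (by linarith) (hA.nested_lie hh hB)).trans ?_
  rw [Real.exp_le_exp]
  -- The constant `4 / 3` is `1 / (1 - μ)` at the largest allowed `μ = 1 / 4`.
  have : 2 * h * k / (1 - 2 * h * k) ≤ 4 / 3 * (2 * h * k) := by
    rw [div_le_iff₀ (by linarith)]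
    nlinarith [show 0 ≤ 2 * h * k by positivity]
  nlinarith [mul_le_mul_of_nonneg_left this (show 0 ≤ h * N by positivity)]

theorem IsLocalExtensive.zero (k : ℕ) {h : ℝ} (hh : 0 ≤ h) :
    IsLocalExtensive k h (0 : SpinOp N d) :=
  ⟨0, 0, fun X => IsSupportedOn.zero X, rfl, fun _ _ => rfl, fun i => by simpa using hh, by simp⟩

theorem IsLocalExtensive.smul {k : ℕ} {h : ℝ} {A : SpinOp N d} (hA : IsLocalExtensive k h A)
    (r : ℝ) : IsLocalExtensive k (|r| * h) (r • A) := by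
  obtain ⟨c, a, ha, h0, hk, hg, rfl⟩ := hA
  refine ⟨r • c, fun X => r • a X, fun X => (ha X).real_smul r, by simp [h0],
    fun X hX => by simp [hk X hX], fun i => ?_, ?_⟩
  · simp only [norm_smul, ← Finset.mul_sum, Real.norm_eq_abs]
    exact mul_le_mul_of_nonneg_left (hg i) (abs_nonneg r)
  · rw [smul_add, Finset.smul_sum, smul_assoc]

theorem IsLocalExtensive.add {k : ℕ} {h h' : ℝ} {A B : SpinOp N d} (hA : IsLocalExtensive k h A)
    (hB : IsLocalExtensive k h' B) : IsLocalExtensive k (h + h') (A + B) := by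
  obtain ⟨c, a, ha, h0, hk, hg, rfl⟩ := hA
  obtain ⟨c', b, hb, h0', hk', hg', rfl⟩ := hB
  refine ⟨c + c', fun X => a X + b X, fun X => (ha X).add (hb X), by simp [h0, h0'],
    fun X hX => by simp [hk X hX, hk' X hX], fun i => ?_, ?_⟩
  · refine (Finset.sum_le_sum fun X _ => norm_add_le _ _).trans ?_
    rw [Finset.sum_add_distrib]
    exact add_le_add (hg i) (hg' i)
  · rw [Finset.sum_add_distrib, add_smul]
    abel

theorem IsLocalExtensive.mono {k : ℕ} {h h' : ℝ} (hh : h ≤ h') {A : SpinOp N d}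
    (hA : IsLocalExtensive k h A) : IsLocalExtensive k h' A := by
  obtain ⟨c, a, ha, h0, hk, hg, rfl⟩ := hA
  exact ⟨c, a, ha, h0, hk, fun i => (hg i).trans hh, rfl⟩

theorem IsSupportedOn.exists_eq_smul_one {a : SpinOp N d} (ha : IsSupportedOn ∅ a) :
    ∃ c : ℂ, a = c • 1 := by
  obtain ⟨b, rfl⟩ := ha
  refine ⟨b default default, ?_⟩
  rw [extendByOne_eq]
  ext s t
  simp [Matrix.one_apply, funext_iff, Subsingleton.elim _ (default : (∅ : Finset (Fin N)) → Fin d)]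

/-- Extensiveness does not control the term with empty support, which lies over no spin; being a
scalar, it is moved into the multiple of the identity. -/
theorem IsLocalSum.localExtensive {k : ℕ} {h : ℝ} {o : Finset (Fin N) → SpinOp N d}
    {O : SpinOp N d} (ho : IsLocalSum o O) (hk : IsKLocal k o) (hg : IsGExtensive h o) :
    IsLocalExtensive k h O := by
  obtain ⟨hs, rfl⟩ := ho
  obtain ⟨c, hc⟩ := (hs ∅).exists_eq_smul_one
  refine ⟨c, Function.update o ∅ 0, fun X => ?_, by simp, fun X hX => ?_,
    fun i => ?_, ?_⟩
  · rcases eq_or_ne X ∅ with rfl | hX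
    · simpa using IsSupportedOn.zero _
    · simpa [hX] using hs X
  · have : X ≠ ∅ := by rintro rfl; simp at hX
    simpa [this] using hk X hX
  · refine le_trans (le_of_eq (Finset.sum_congr rfl fun X hX => ?_)) (hg i)
    have : X ≠ ∅ := by rintro rfl; simp at hX
    simp [this]
  · rw [← hc, ← Finset.add_sum_erase _ _ (Finset.mem_univ ∅),
      ← Finset.add_sum_erase _ (Function.update o ∅ 0) (Finset.mem_univ ∅),
      Function.update_self, zero_add]
    congr 1
    exact Finset.sum_congr rfl fun X hX => by simp [Finset.ne_of_mem_erase hX]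

end Locality

/-! ### Expectation values in a state. -/

section Expectation

variable {m : Type*} [Fintype m] [DecidableEq m]

/-- The real part of the expectation value `tr (X ρ)`, as a real linear functional of `X`. -/
def stateExpect (ρ : Matrix m m ℂ) : Matrix m m ℂ →ₗ[ℝ] ℝ where
  toFun X := ((X * ρ).trace).re
  map_add' X Y := by simp [add_mul]
  map_smul' r X := by simp

theorem stateExpect_apply (ρ X : Matrix m m ℂ) : stateExpect ρ X = ((X * ρ).trace).re := rfl

open scoped MatrixOrder

theorem trace_mul_nonneg_of_nonneg {ρ X : Matrix m m ℂ} (hρ : ρ.PosSemidef) (hX : 0 ≤ X) :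
    0 ≤ (X * ρ).trace := by
  obtain ⟨b, rfl⟩ := CStarAlgebra.nonneg_iff_eq_star_mul_self.mp hX
  rw [mul_assoc, Matrix.trace_mul_comm]
  exact (hρ.mul_mul_conjTranspose_same b).trace_nonneg

theorem stateExpect_mono {ρ X Y : Matrix m m ℂ} (hρ : ρ.PosSemidef) (h : X ≤ Y) :
    stateExpect ρ X ≤ stateExpect ρ Y := by
  have := (Complex.le_def.1 (trace_mul_nonneg_of_nonneg hρ (sub_nonneg.2 h))).1
  rwa [Complex.zero_re, ← stateExpect_apply, map_sub, sub_nonneg] at this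

theorem stateExpect_nonneg {ρ X : Matrix m m ℂ} (hρ : ρ.PosSemidef) (h : 0 ≤ X) :
    0 ≤ stateExpect ρ X := by
  simpa using stateExpect_mono hρ h

theorem stateExpect_one {ρ : Matrix m m ℂ} (hρ : IsDensityMatrix ρ) : stateExpect ρ 1 = 1 := by
  simp [stateExpect_apply, hρ.2]

theorem stateExpect_algebraMap {ρ : Matrix m m ℂ} (hρ : IsDensityMatrix ρ) (r : ℝ) :
    stateExpect ρ (algebraMap ℝ _ r) = r := by
  rw [Algebra.algebraMap_eq_smul_one, map_smul, stateExpect_one hρ, smul_eq_mul, mul_one]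

theorem abs_stateExpect_le {ρ X : Matrix m m ℂ} (hρ : IsDensityMatrix ρ) (hX : IsSelfAdjoint X) :
    |stateExpect ρ X| ≤ ‖X‖ := by
  rw [abs_le]
  constructor
  · have := stateExpect_mono hρ.1 hX.neg_algebraMap_norm_le_self
    rwa [map_neg, stateExpect_algebraMap hρ] at this
  · have := stateExpect_mono hρ.1 hX.le_algebraMap_norm_self
    rwa [stateExpect_algebraMap hρ] at this

theorem isSelfAdjoint_exp {X : Matrix m m ℂ} (hX : IsSelfAdjoint X) :
    IsSelfAdjoint (NormedSpace.exp X) := by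
  rw [← CFC.real_exp_eq_normedSpace_exp hX]
  exact cfc_predicate _ _

theorem exp_nonneg_of_isSelfAdjoint {X : Matrix m m ℂ} (hX : IsSelfAdjoint X) :
    0 ≤ NormedSpace.exp X := by
  rw [← CFC.real_exp_eq_normedSpace_exp hX]
  exact cfc_nonneg fun x _ => (Real.exp_pos x).le

/-- A Cauchy-Schwarz inequality for the state `ρ`. -/
theorem stateExpect_mul_mul_le {ρ P Ψ Q : Matrix m m ℂ} (hρ : ρ.PosSemidef) {L E : ℝ} (hL : 0 < L)
    (hΨ : ‖Ψ‖ ≤ L) (hP : stateExpect ρ (star P * P) ≤ E) (hQ : stateExpect ρ (star Q * Q) ≤ E) :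
    stateExpect ρ (star P * Ψ * Q) ≤ L * E := by
  have h1 : stateExpect ρ (star (Ψ * Q) * (Ψ * Q)) ≤ L ^ 2 * E := by
    have h2 : star (Ψ * Q) * (Ψ * Q) ≤ ‖Ψ‖ ^ 2 • (star Q * Q) := by
      have := star_left_conjugate_le_conjugate
        (CStarAlgebra.star_mul_le_algebraMap_norm_sq (a := Ψ)) Q
      rw [Algebra.algebraMap_eq_smul_one, mul_smul_comm, smul_mul_assoc, mul_one] at this
      simpa only [star_mul, mul_assoc] using this
    refine (stateExpect_mono hρ h2).trans ?_
    rw [map_smul, smul_eq_mul]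
    have h3 : 0 ≤ stateExpect ρ (star Q * Q) := stateExpect_nonneg hρ (star_mul_self_nonneg Q)
    exact mul_le_mul (pow_le_pow_left₀ (norm_nonneg _) hΨ 2) hQ h3 (by positivity)
  have h4 : stateExpect ρ (star (Ψ * Q) * P) = stateExpect ρ (star P * Ψ * Q) := by
    simp only [stateExpect_apply]
    rw [← Complex.conj_re, starRingEnd_apply, ← Matrix.trace_conjTranspose]
    rw [Matrix.conjTranspose_mul, hρ.1.eq, Matrix.trace_mul_comm]
    simp [Matrix.star_eq_conjTranspose, mul_assoc]
  -- Expanding the square gives `2L` times the wanted expectation on one side and at most `2L²E` on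
  -- the other.
  have h5 := stateExpect_nonneg hρ (star_mul_self_nonneg (L • P - Ψ * Q))
  have h6 : star (L • P - Ψ * Q) * (L • P - Ψ * Q) = (L ^ 2) • (star P * P) -
      L • (star P * Ψ * Q) - L • (star (Ψ * Q) * P) + star (Ψ * Q) * (Ψ * Q) := by
    simp only [star_sub, star_smul, star_trivial, sub_mul, mul_sub, smul_mul_assoc, mul_smul_comm,
      mul_assoc, smul_sub, pow_two, mul_smul]
    abel
  rw [h6, map_add, map_sub, map_sub, map_smul, map_smul, map_smul, h4] at h5
  simp only [smul_eq_mul] at h5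
  nlinarith

/-- The linear term vanishes in expectation for a centred observable, which leaves a Gaussian bound
with no restriction on the norm. -/
theorem exp_le_add_exp_sq (y : ℝ) : Real.exp y ≤ y + Real.exp (y ^ 2) := by
  have h2 := Real.add_one_le_exp (y ^ 2)
  rcases le_or_gt |y| 1 with h | h
  · have := (abs_le.1 (Real.abs_exp_sub_one_sub_id_le h)).2
    linarith
  · rcases lt_abs.1 h with h | h
    · have : Real.exp y ≤ Real.exp (y ^ 2) := Real.exp_le_exp.2 (by nlinarith)
      linarith
    · have : Real.exp y ≤ 1 := Real.exp_le_one_iff.2 (by linarith)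
      nlinarith

theorem stateExpect_exp_le {ρ X : Matrix m m ℂ} (hρ : IsDensityMatrix ρ) (hX : IsSelfAdjoint X)
    (h0 : stateExpect ρ X = 0) {M : ℝ} (hM : ‖X‖ ≤ M) :
    stateExpect ρ (NormedSpace.exp X) ≤ Real.exp (M ^ 2) := by
  have h1 : NormedSpace.exp X ≤ X + algebraMap ℝ _ (Real.exp (M ^ 2)) := by
    rw [← CFC.real_exp_eq_normedSpace_exp hX]
    calc cfc Real.exp X ≤ cfc (fun y => y + Real.exp (M ^ 2)) X := by
          refine cfc_mono fun y hy => (exp_le_add_exp_sq y).trans ?_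
          have hy' : |y| ≤ M := (spectrum.norm_le_norm_mul_of_mem hy).trans
            ((mul_le_of_le_one_right (norm_nonneg _) norm_one_matrix_le).trans hM)
          have : y ^ 2 ≤ M ^ 2 := sq_le_sq' (by linarith [neg_abs_le y]) ((le_abs_self y).trans hy')
          gcongr
      _ = X + algebraMap ℝ _ (Real.exp (M ^ 2)) := by
          rw [cfc_add_const _ (fun y => y) X, cfc_id' ℝ X]
  have := stateExpect_mono hρ.1 h1
  rwa [map_add, h0, stateExpect_algebraMap hρ, zero_add] at this

end Expectation

/-! ### Moment generating functions: the pairwise merge and the non-overlapping case. -/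

section MomentBounds

variable {N d : ℕ}

theorem exp_half_mul_exp_half {m : Type*} [Fintype m] [DecidableEq m] (A : Matrix m m ℂ) :
    NormedSpace.exp ((1 / 2 : ℝ) • A) * NormedSpace.exp ((1 / 2 : ℝ) • A) = NormedSpace.exp A := by
  rw [← Matrix.exp_add_of_commute _ _ (Commute.refl _), ← add_smul]
  norm_num

theorem stateExpect_exp_half_add_le {ρ : SpinOp N d} (hρ : ρ.PosSemidef) {k : ℕ} {h E : ℝ}
    (hh : 0 ≤ h) (hk : 2 * h * k ≤ 1 / 4) {A B : SpinOp N d} (hA : IsSelfAdjoint A)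
    (hB : IsSelfAdjoint B) (hAl : IsLocalExtensive k (2 * h) A) (hBl : IsLocalExtensive k (2 * h) B)
    (hAE : stateExpect ρ (NormedSpace.exp A) ≤ E) (hBE : stateExpect ρ (NormedSpace.exp B) ≤ E) :
    stateExpect ρ (NormedSpace.exp ((1 / 2 : ℝ) • (A + B))) ≤
      Real.exp (4 / 3 * (h * N * (2 * h * k))) * E := by
  have hl : ∀ {C : SpinOp N d}, IsLocalExtensive k (2 * h) C →
      IsLocalExtensive k h ((1 / 2 : ℝ) • C) := fun hC =>
    (hC.smul (1 / 2)).mono (by rw [abs_of_nonneg (by norm_num)]; linarith)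
  have hs : ∀ {C : SpinOp N d}, IsSelfAdjoint C →
      star (NormedSpace.exp ((1 / 2 : ℝ) • C)) = NormedSpace.exp ((1 / 2 : ℝ) • C) := fun hC =>
    isSelfAdjoint_exp ((IsSelfAdjoint.all (1 / 2 : ℝ)).smul hC)
  have key := stateExpect_mul_mul_le (P := NormedSpace.exp ((1 / 2 : ℝ) • A))
    (Q := NormedSpace.exp ((1 / 2 : ℝ) • B)) (E := E) hρ (Real.exp_pos _)
    ((hl hAl).norm_exp_splitting_le hh hk (hl hBl))
    (by rwa [hs hA, exp_half_mul_exp_half]) (by rwa [hs hB, exp_half_mul_exp_half])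
  convert key using 2
  rw [hs hA, smul_add]
  generalize (1 / 2 : ℝ) • A = A', (1 / 2 : ℝ) • B = B'
  rw [← mul_assoc, ← mul_assoc, exp_mul_exp_neg_self, one_mul, mul_assoc, exp_neg_mul_exp_self,
    mul_one]

theorem dyadic_average_succ {M : Type*} [AddCommGroup M] [Module ℝ M] (q : ℕ) (c : ℕ → M) :
    (1 / 2 ^ (q + 1) : ℝ) • ∑ j ∈ Finset.range (2 ^ (q + 1)), c j =
      (1 / 2 : ℝ) • ((1 / 2 ^ q : ℝ) • ∑ j ∈ Finset.range (2 ^ q), c j +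
        (1 / 2 ^ q : ℝ) • ∑ j ∈ Finset.range (2 ^ q), c (2 ^ q + j)) := by
  rw [show 2 ^ (q + 1) = 2 ^ q + 2 ^ q by ring, Finset.sum_range_add, ← smul_add, smul_smul]
  congr 1
  rw [pow_succ]
  field_simp

/-- Averaging two operators preserves `2 * h`-extensiveness, so every level of the tree costs the
same factor. -/
theorem stateExpect_exp_dyadic_average_le {ρ : SpinOp N d} (hρ : ρ.PosSemidef) {k : ℕ} {h E : ℝ}
    (hh : 0 ≤ h) (hk : 2 * h * k ≤ 1 / 4) (q : ℕ) (c : ℕ → SpinOp N d)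
    (hc : ∀ j, IsSelfAdjoint (c j)) (hcl : ∀ j, IsLocalExtensive k (2 * h) (c j))
    (hcE : ∀ j, stateExpect ρ (NormedSpace.exp (c j)) ≤ E) :
    let S := (1 / 2 ^ q : ℝ) • ∑ j ∈ Finset.range (2 ^ q), c j
    IsSelfAdjoint S ∧ IsLocalExtensive k (2 * h) S ∧
      stateExpect ρ (NormedSpace.exp S) ≤ Real.exp (4 / 3 * (h * N * (2 * h * k))) ^ q * E := by
  induction q generalizing c with
  | zero => simpa using ⟨hc 0, hcl 0, hcE 0⟩
  | succ q ih =>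
    obtain ⟨s1, l1, e1⟩ := ih c hc hcl hcE
    obtain ⟨s2, l2, e2⟩ := ih (fun j => c (2 ^ q + j)) (fun j => hc _) (fun j => hcl _)
      (fun j => hcE _)
    dsimp only
    rw [dyadic_average_succ]
    refine ⟨(IsSelfAdjoint.all (1 / 2 : ℝ)).smul (s1.add s2), ((l1.add l2).smul (1 / 2)).mono ?_, ?_⟩
    · rw [abs_of_nonneg (by norm_num)]
      linarith
    · refine (stateExpect_exp_half_add_le hρ hh hk s1 s2 l1 l2 e1 e2).trans_eq ?_
      rw [pow_succ' (Real.exp _), mul_assoc (Real.exp _)]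

/-- In a product state, the moment generating function of a sum of operators with disjoint
supports factorizes. -/
theorem trace_exp_sum_of_disjoint {r : Fin N → Matrix (Fin d) (Fin d) ℂ}
    (hr : (tensorProd r).trace = 1) {f : Finset (Fin N) → SpinOp N d}
    (hf : ∀ X, IsSupportedOn X (f X)) (hd : IsNonOverlapping f) (s : Finset (Finset (Fin N))) :
    (tensorProd r * NormedSpace.exp (∑ X ∈ s, f X)).trace =
      ∏ X ∈ s, (tensorProd r * NormedSpace.exp (f X)).trace := by
  induction s using Finset.induction_on with
  | empty => simpa using hr
  | insert X s hX ih =>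
    rw [Finset.sum_insert hX, Finset.prod_insert hX, ← ih]
    rcases eq_or_ne (f X) 0 with h0 | h0
    · simp [h0, hr]
    · have hs : IsSupportedOn Xᶜ (∑ Y ∈ s, f Y) := by
        refine IsSupportedOn.sum fun Y hY => ?_
        rcases eq_or_ne (f Y) 0 with h1 | h1
        · exact h1 ▸ IsSupportedOn.zero _
        · refine (hf Y).mono (le_compl_iff_disjoint_left.2 (hd X Y ?_ h0 h1))
          rintro rfl
          exact hX hY
      rw [Matrix.exp_add_of_commute _ _ ((hf X).commute disjoint_compl_right hs)]
      exact trace_tensorProd_mul_mul hr disjoint_compl_right (hf X).exp hs.exp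

theorem IsProductState.trace_eq_one {ρ : SpinOp N d} (hρ : IsProductState ρ) :
    ρ.trace = 1 := by
  obtain ⟨r, hr, rfl⟩ := hρ
  rw [trace_tensorProd, Finset.prod_eq_one fun i _ => (hr i).2]

theorem star_tensorProd_mul (r : Fin N → Matrix (Fin d) (Fin d) ℂ) :
    star (tensorProd r) * tensorProd r = tensorProd fun i => star (r i) * r i := by
  ext s t
  simp only [tensorProd, Matrix.mul_apply, Matrix.star_eq_conjTranspose, Matrix.conjTranspose_apply, Matrix.of_apply, star_prod,
    ← Finset.prod_mul_distrib]
  exact (Fintype.prod_sum fun i j => star (r i j (s i)) * r i j (t i)).symm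

open scoped MatrixOrder in
theorem IsProductState.isDensityMatrix {ρ : SpinOp N d} (hρ : IsProductState ρ) :
    IsDensityMatrix ρ := by
  refine ⟨?_, hρ.trace_eq_one⟩
  obtain ⟨r, hr, rfl⟩ := hρ
  choose b hb using fun i => CStarAlgebra.nonneg_iff_eq_star_mul_self.mp (hr i).1.nonneg
  rw [show r = fun i => star (b i) * b i from funext hb, ← star_tensorProd_mul]
  exact Matrix.posSemidef_conjTranspose_mul_self _

theorem isSelfAdjoint_half_add_star {𝔸 : Type*} [AddCommGroup 𝔸] [StarAddMonoid 𝔸] [Module ℝ 𝔸]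
    [StarModule ℝ 𝔸] (a : 𝔸) : IsSelfAdjoint ((1 / 2 : ℝ) • (a + star a)) :=
  (IsSelfAdjoint.all (1 / 2 : ℝ)).smul (IsSelfAdjoint.add_star_self a)

theorem stateExpect_exp_nonoverlapping_le {ρ : SpinOp N d} (hρ : IsProductState ρ)
    {a : Finset (Fin N) → SpinOp N d} {O : SpinOp N d} (ha : IsLocalSum a O)
    (hd : IsNonOverlapping a) (hO : IsSelfAdjoint O) (h0 : stateExpect ρ O = 0) (θ : ℝ) :
    stateExpect ρ (NormedSpace.exp (θ • O)) ≤
      Real.exp (4 * θ ^ 2 * ∑ X : Finset (Fin N) with X.Nonempty, ‖a X‖ ^ 2) := by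
  have hρd := hρ.isDensityMatrix
  obtain ⟨r, hr, rfl⟩ := hρ
  obtain ⟨hs, rfl⟩ := ha
  set ρ := tensorProd r
  -- The single terms need be neither Hermitian nor centred. Taking Hermitian parts and subtracting
  -- means leaves the total unchanged, as the total has both properties; the norms at most double.
  let b : Finset (Fin N) → SpinOp N d := fun X => (1 / 2 : ℝ) • (a X + star (a X))
  have hbn : ∀ X, ‖b X‖ ≤ ‖a X‖ := fun X => by
    rw [norm_smul, Real.norm_of_nonneg (by norm_num)]
    linarith [norm_add_le (a X) (star (a X)), norm_star (a X)]
  let f : Finset (Fin N) → SpinOp N d := fun X => θ • (b X - stateExpect ρ (b X) • 1)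
  have hfs : ∀ X, IsSupportedOn X (f X) := fun X => by
    refine ((((hs X).add (hs X).star).real_smul _).sub ?_).real_smul θ
    simpa using IsSupportedOn.smul_one X (stateExpect ρ (b X) : ℂ)
  have hfa : ∀ X, IsSelfAdjoint (f X) := fun X =>
    (IsSelfAdjoint.all θ).smul ((isSelfAdjoint_half_add_star _).sub
      ((IsSelfAdjoint.all (stateExpect ρ (b X))).smul (IsSelfAdjoint.one _)))
  have hf0 : ∀ X, stateExpect ρ (f X) = 0 := fun X => by
    simp only [f, map_smul, map_sub, stateExpect_one hρd, smul_eq_mul, mul_one, sub_self, mul_zero]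
  have hfn : ∀ X, ‖f X‖ ≤ |θ| * (2 * ‖a X‖) := fun X => by
    rw [norm_smul, Real.norm_eq_abs]
    refine mul_le_mul_of_nonneg_left ((norm_sub_le _ _).trans ?_) (abs_nonneg θ)
    have h1 : ‖stateExpect ρ (b X) • (1 : SpinOp N d)‖ ≤ ‖b X‖ := by
      rw [norm_smul, Real.norm_eq_abs]
      exact (mul_le_of_le_one_right (abs_nonneg _) norm_one_matrix_le).trans
        (abs_stateExpect_le hρd (isSelfAdjoint_half_add_star _))
    linarith [hbn X]
  have hfd : IsNonOverlapping f := by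
    have : ∀ X, f X ≠ 0 → a X ≠ 0 := fun X hX haX => hX (by simp [f, b, haX])
    exact fun X Y hXY hX hY => hd X Y hXY (this X hX) (this Y hY)
  -- Centring cancels the scalar term, so the empty set is absent from the final sum.
  have hfe : f ∅ = 0 := by
    obtain ⟨c, hc⟩ := (hs ∅).exists_eq_smul_one
    have hb : b ∅ = c.re • 1 := by
      simp only [b, hc]
      ext s t
      simp [Matrix.one_apply]
      split_ifs <;> simp [Complex.ext_iff]
      ring
    simp [f, hb, stateExpect_one hρd]
  have hsum : ∑ X, f X = θ • ∑ X, a X := by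
    have hb : ∑ X, b X = ∑ X, a X := by
      simp only [b]
      rw [← Finset.smul_sum, Finset.sum_add_distrib, ← star_sum, hO.star_eq, ← two_smul ℝ,
        smul_smul]
      norm_num
    simp only [f]
    rw [← Finset.smul_sum, Finset.sum_sub_distrib, ← Finset.sum_smul, ← map_sum, hb, h0, zero_smul,
      sub_zero]
  have hnorm : ∀ X, ‖(ρ * NormedSpace.exp (f X)).trace‖ = stateExpect ρ (NormedSpace.exp (f X)) :=
    fun X => by
      rw [Matrix.trace_mul_comm, stateExpect_apply]
      exact (Complex.re_eq_norm.2 (trace_mul_nonneg_of_nonneg hρd.1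
        (exp_nonneg_of_isSelfAdjoint (hfa X)))).symm
  calc stateExpect ρ (NormedSpace.exp (θ • ∑ X, a X))
      = ((ρ * NormedSpace.exp (∑ X, f X)).trace).re := by
        rw [hsum, Matrix.trace_mul_comm, stateExpect_apply]
    _ ≤ ‖(ρ * NormedSpace.exp (∑ X, f X)).trace‖ := Complex.re_le_norm _
    _ = ∏ X, stateExpect ρ (NormedSpace.exp (f X)) := by
        rw [trace_exp_sum_of_disjoint hρd.2 hfs hfd, norm_prod]
        exact Finset.prod_congr rfl fun X _ => hnorm X
    _ ≤ ∏ X : Finset (Fin N), Real.exp (if X.Nonempty then (|θ| * (2 * ‖a X‖)) ^ 2 else 0) := by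
        refine Finset.prod_le_prod
          (fun X _ => stateExpect_nonneg hρd.1 (exp_nonneg_of_isSelfAdjoint (hfa X))) fun X _ => ?_
        split_ifs with hX
        · exact stateExpect_exp_le hρd (hfa X) (hf0 X) (hfn X)
        · rw [Finset.not_nonempty_iff_eq_empty.1 hX, hfe, NormedSpace.exp_zero, stateExpect_one hρd,
            Real.exp_zero]
    _ = _ := by
        rw [← Real.exp_sum, ← Finset.sum_filter, Finset.mul_sum]
        congr 1
        refine Finset.sum_congr rfl fun X _ => ?_
        rw [mul_pow, sq_abs]
        ring

end MomentBounds

/-! ### From moment generating functions to tails, and the average of `n` operators. -/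

section ChernoffBounds

variable {N d : ℕ}

open scoped MatrixOrder in
/-- Markov's inequality for the exponential of an observable. -/
theorem stateExpect_spectralProj_le {ρ A : SpinOp N d} (hρ : ρ.PosSemidef) (hA : IsSelfAdjoint A)
    {S : Set ℝ} {τ y : ℝ} (hS : ∀ z ∈ S, y ≤ τ * z) :
    stateExpect ρ (spectralProj A S) ≤ Real.exp (-y) * stateExpect ρ (NormedSpace.exp (τ • A)) := by
  -- On a finite spectrum the indicator function is continuous, as the functional calculus requires.
  have hfin : (spectrum ℝ A).Finite := Matrix.finite_real_spectrum
  have hτ : IsSelfAdjoint (τ • A) := (IsSelfAdjoint.all τ).smul hA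
  have h1 : NormedSpace.exp (τ • A) = cfc (fun z => Real.exp (τ * z)) A := by
    rw [← CFC.real_exp_eq_normedSpace_exp hτ, ← cfc_const_mul_id τ A,
      ← cfc_comp' Real.exp (fun z => τ * z) A (by fun_prop) (by fun_prop) hA]
  have h2 : spectralProj A S ≤ Real.exp (-y) • NormedSpace.exp (τ • A) := by
    rw [h1, ← cfc_smul (Real.exp (-y)) (fun z => Real.exp (τ * z)) A (by fun_prop), spectralProj]
    refine cfc_mono (fun z _ => ?_) (hfin.continuousOn _)
    by_cases hz : z ∈ S
    · rw [Set.indicator_of_mem hz, smul_eq_mul, ← Real.exp_add, Real.one_le_exp_iff]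
      linarith [hS z hz]
    · rw [Set.indicator_of_notMem hz]
      positivity
  simpa using stateExpect_mono hρ h2

/-- The unconstrained optimum is `x / (2 * K * L)`. If it is too large, the endpoint `1 / (4 * lam)`
is used, where the quadratic term is at most half of the linear one. -/
theorem exists_chernoff_exponent {K L lam x : ℝ} (hK : 0 < K) (hL : 0 < L) (hlam : 0 < lam)
    (hx : 0 ≤ x) : ∃ τ, 0 ≤ τ ∧ τ ≤ 1 / (4 * lam) ∧ Real.exp (-(τ * x)) * Real.exp (K * L * τ ^ 2) ≤
      max (Real.exp (-(x ^ 2 / (4 * K * L)))) (Real.exp (-(x / (8 * lam)))) := by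
  rcases le_or_gt (x / (2 * K * L)) (1 / (4 * lam)) with h | h
  · refine ⟨x / (2 * K * L), by positivity, h, le_max_of_le_left (le_of_eq ?_)⟩
    rw [← Real.exp_add]
    congr 1
    field_simp
    ring
  · refine ⟨1 / (4 * lam), by positivity, le_rfl, le_max_of_le_right ?_⟩
    rw [← Real.exp_add, Real.exp_le_exp]
    rw [div_lt_div_iff₀ (by positivity) (by positivity)] at h
    have h1 : K * L * (1 / (4 * lam)) ^ 2 ≤ x * (2 * lam) * (1 / (4 * lam)) ^ 2 :=
      mul_le_mul_of_nonneg_right (by linarith) (by positivity)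
    have h2 : x * (2 * lam) * (1 / (4 * lam)) ^ 2 = x / (8 * lam) := by field_simp; ring
    have h3 : 1 / (4 * lam) * x = x / (8 * lam) + x / (8 * lam) := by field_simp; ring
    linarith

theorem ChernoffBounds.of_exp_le {ρ A : SpinOp N d} (hN : 0 < N) (hρ : IsDensityMatrix ρ)
    (hA : IsSelfAdjoint A) {lam K : ℝ} (hlam : 0 < lam) (hK : 0 < K)
    (h : ∀ τ : ℝ, |τ| ≤ 1 / (4 * lam) →
      stateExpect ρ (NormedSpace.exp (τ • A)) ≤ Real.exp (K * N * τ ^ 2)) :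
    ChernoffBounds A ρ lam K := by
  have hN' : (0 : ℝ) < N := by exact_mod_cast hN
  refine ⟨fun τ hτ => ?_, fun x hx => ?_, fun x hx => ?_⟩
  · have h0 : 0 ≤ stateExpect ρ (NormedSpace.exp (τ • A)) :=
      stateExpect_nonneg hρ.1 (exp_nonneg_of_isSelfAdjoint ((IsSelfAdjoint.all τ).smul hA))
    change Real.log (stateExpect ρ (NormedSpace.exp (τ • A))) ≤ _
    rcases h0.eq_or_lt with h1 | h1
    -- The convention `log 0 = 0` settles this case, so strict positivity of the trace need not be
    -- proved.
    · rw [← h1, Real.log_zero]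
      positivity
    · exact (Real.log_le_iff_le_exp h1).2 (h τ hτ)
  · obtain ⟨τ, hτ0, hτ1, hτ⟩ := exists_chernoff_exponent hK hN' hlam hx
    refine ((stateExpect_spectralProj_le hρ.1 hA (S := Set.Ici x) (τ := τ) (y := τ * x)
      fun z hz => mul_le_mul_of_nonneg_left hz hτ0).trans ?_).trans hτ
    exact mul_le_mul_of_nonneg_left (h τ (by rwa [abs_of_nonneg hτ0])) (Real.exp_pos _).le
  · obtain ⟨τ, hτ0, hτ1, hτ⟩ := exists_chernoff_exponent hK hN' hlam hx
    refine ((stateExpect_spectralProj_le hρ.1 hA (S := Set.Iic (-x)) (τ := -τ) (y := τ * x)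
      fun z hz => ?_).trans ?_).trans hτ
    · have hz' : z ≤ -x := hz
      nlinarith
    · have := h (-τ) (by rwa [abs_neg, abs_of_nonneg hτ0])
      rw [neg_sq] at this
      exact mul_le_mul_of_nonneg_left this (Real.exp_pos _).le

theorem two_pow_clog_le {n : ℕ} (hn : 1 ≤ n) : 2 ^ Nat.clog 2 n ≤ 2 * n := by
  rcases hn.eq_or_lt with rfl | h
  · simp
  · have h1 := Nat.pow_pred_clog_lt_self one_lt_two h
    have h2 : Nat.clog 2 n = (Nat.clog 2 n).pred + 1 :=
      (Nat.succ_pred_eq_of_pos (Nat.clog_pos one_lt_two h)).symm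
    rw [h2, pow_succ]
    omega

theorem chernoffConst_eq (C g : ℝ) (k n : ℕ) :
    chernoffConst C g k n = 2 * g ^ 2 * C / k + 3 * (2 * g * k) * g / 2 * (Nat.clog 2 n : ℝ) := by
  have : ⌈Real.logb 2 n⌉ = (Nat.clog 2 n : ℤ) := by
    have := Real.ceil_logb_natCast (b := 2) (r := (n : ℝ)) (Nat.cast_nonneg n)
    rw [Int.clog_natCast] at this
    exact_mod_cast this
  rw [chernoffConst, this, Int.cast_natCast]

theorem stateExpect_exp_average_le {k n : ℕ} {g S : ℝ} (hn : 1 ≤ n) (hg : 0 < g) {ρ : SpinOp N d}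
    (hρ : IsProductState ρ) {Ac : Fin n → SpinOp N d} {a : Fin n → Finset (Fin N) → SpinOp N d}
    (ha : ∀ j, IsLocalSum (a j) (Ac j)) (hk : ∀ j, IsKLocal k (a j))
    (hga : ∀ j, IsGExtensive g (a j)) (hd : ∀ j, IsNonOverlapping (a j))
    (hA : ∀ j, IsSelfAdjoint (Ac j)) (h0 : ∀ j, stateExpect ρ (Ac j) = 0)
    (hS : ∀ j, ∑ X : Finset (Fin N) with X.Nonempty, ‖a j X‖ ^ 2 ≤ S) {τ : ℝ}
    (hτ : 2 * (|τ| * g) * k ≤ 1 / 4) :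
    stateExpect ρ (NormedSpace.exp (τ • ((1 / (n : ℝ)) • ∑ j, Ac j))) ≤
      Real.exp (16 * S * τ ^ 2 + 3 * (2 * g * k) * g / 2 * (Nat.clog 2 n : ℝ) * N * τ ^ 2) := by
  set q := Nat.clog 2 n
  have hn0 : (0 : ℝ) < n := by exact_mod_cast hn
  have hS0 : 0 ≤ S := (Finset.sum_nonneg fun X _ => by positivity).trans (hS ⟨0, hn⟩)
  have hρd := hρ.isDensityMatrix
  -- The family is padded with zeros to length `2 ^ q`; the rescaling keeps the average unchanged
  -- and, as `2 ^ q ≤ 2 * n`, at most doubles the parameter.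
  set θ : ℝ := τ * (2 ^ q / n) with hθ
  have hq : (2 ^ q / n : ℝ) ≤ 2 := by
    rw [div_le_iff₀ hn0]
    exact_mod_cast two_pow_clog_le hn
  have hθ2 : |θ| ≤ 2 * |τ| := by
    rw [hθ, abs_mul, abs_of_nonneg (by positivity : (0 : ℝ) ≤ 2 ^ q / n), mul_comm]
    exact mul_le_mul_of_nonneg_right hq (abs_nonneg τ)
  let c : ℕ → SpinOp N d := fun j => if h : j < n then θ • Ac ⟨j, h⟩ else 0
  have hsum : (1 / 2 ^ q : ℝ) • ∑ j ∈ Finset.range (2 ^ q), c j =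
      τ • ((1 / (n : ℝ)) • ∑ j, Ac j) := by
    have h1 : ∑ j ∈ Finset.range (2 ^ q), c j = ∑ j ∈ Finset.range n, c j := by
      refine (Finset.sum_subset (Finset.range_mono (Nat.le_pow_clog one_lt_two n))
        fun j _ hj => ?_).symm
      simp [c, Finset.mem_range.not.1 hj]
    rw [h1, Finset.sum_range]
    simp only [c, Fin.is_lt, dite_true, Fin.eta, ← Finset.smul_sum, smul_smul]
    congr 1
    rw [hθ]
    field_simp
  have key := (stateExpect_exp_dyadic_average_le hρd.1 (h := |τ| * g) (E := Real.exp (16 * S * τ ^ 2))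
    (by positivity) hτ q c (fun j => ?_) (fun j => ?_) (fun j => ?_)).2.2
  · rw [hsum] at key
    refine key.trans ?_
    rw [← Real.exp_nat_mul, ← Real.exp_add, Real.exp_le_exp, add_comm]
    -- The cost per level is `8 / 3` times `g ^ 2 * k * N * τ ^ 2`, below the `3` of the stated
    -- constant.
    have e : (q : ℝ) * (4 / 3 * (|τ| * g * N * (2 * (|τ| * g) * k))) =
        8 / 3 * (g ^ 2 * k * q * N * τ ^ 2) := by
      rw [← sq_abs τ]
      ring
    rw [e]
    have : 0 ≤ g ^ 2 * k * q * N * τ ^ 2 := by positivity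
    linarith
  · by_cases hj : j < n
    · simpa only [c, hj, dite_true] using (IsSelfAdjoint.all θ).smul (hA _)
    · simp [c, hj]
  · by_cases hj : j < n
    · simp only [c, hj, dite_true]
      refine (((ha _).localExtensive (hk _) (hga _)).smul θ).mono ?_
      rw [← mul_assoc]
      exact mul_le_mul_of_nonneg_right hθ2 hg.le
    · simpa only [c, hj, dite_false] using IsLocalExtensive.zero k (by positivity)
  · by_cases hj : j < n
    · simp only [c, hj, dite_true]
      refine (stateExpect_exp_nonoverlapping_le hρ (ha _) (hd _) (hA _) (h0 _) θ).trans ?_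
      rw [Real.exp_le_exp]
      have h1 : θ ^ 2 ≤ 4 * τ ^ 2 := by
        rw [← sq_abs θ, ← sq_abs τ]
        nlinarith [abs_nonneg θ, abs_nonneg τ]
      calc 4 * θ ^ 2 * ∑ X : Finset (Fin N) with X.Nonempty, ‖a ⟨j, hj⟩ X‖ ^ 2
          ≤ 4 * (4 * τ ^ 2) * S := by
            refine mul_le_mul (by linarith) (hS _) (Finset.sum_nonneg fun X _ => by positivity)
              (by positivity)
        _ = 16 * S * τ ^ 2 := by ring
    · simp only [c, hj, dite_false, NormedSpace.exp_zero, stateExpect_one hρd]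
      exact Real.one_le_exp (by positivity)

theorem IsGExtensive.norm_le {g : ℝ} {o : Finset (Fin N) → SpinOp N d} (ho : IsGExtensive g o)
    {X : Finset (Fin N)} (hX : X.Nonempty) : ‖o X‖ ≤ g := by
  obtain ⟨i, hi⟩ := hX
  exact (Finset.single_le_sum (f := fun X => ‖o X‖) (fun Y _ => norm_nonneg _)
    (Finset.mem_filter.2 ⟨Finset.mem_univ X, hi⟩)).trans (ho i)

/-- One factor of each square is at most `g`; extensiveness sums the other. This replaces the count
of terms when no bound on it is given. -/
theorem IsGExtensive.sum_sq_le {g : ℝ} (hg : 0 ≤ g) {o : Finset (Fin N) → SpinOp N d}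
    (ho : IsGExtensive g o) :
    ∑ X : Finset (Fin N) with X.Nonempty, ‖o X‖ ^ 2 ≤ g ^ 2 * N := by
  calc ∑ X : Finset (Fin N) with X.Nonempty, ‖o X‖ ^ 2
      ≤ ∑ X : Finset (Fin N) with X.Nonempty, g * ‖o X‖ := by
        refine Finset.sum_le_sum fun X hX => ?_
        rw [pow_two]
        exact mul_le_mul_of_nonneg_right (ho.norm_le (Finset.mem_filter.1 hX).2) (norm_nonneg _)
    _ ≤ g * (g * N) := by
        rw [← Finset.mul_sum]
        exact mul_le_mul_of_nonneg_left ho.sum_nonempty_le hg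
    _ = g ^ 2 * N := by ring

theorem IsGExtensive.sum_sq_le_numTerms {g : ℝ} {o : Finset (Fin N) → SpinOp N d}
    (ho : IsGExtensive g o) :
    ∑ X : Finset (Fin N) with X.Nonempty, ‖o X‖ ^ 2 ≤ numTerms o * g ^ 2 := by
  classical
  rw [numTerms, ← nsmul_eq_mul]
  refine le_trans (le_of_eq ?_) (Finset.sum_le_card_nsmul _ (fun X => ‖o X‖ ^ 2) _ fun X hX => ?_)
  · refine (Finset.sum_subset (fun X hX => ?_) fun X hX hX' => ?_).symm
    · simp only [Finset.mem_filter] at hX ⊢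
      exact ⟨hX.1, hX.2.1⟩
    · have : o X = 0 := by
        by_contra h
        exact hX' (Finset.mem_filter.2 ⟨Finset.mem_univ X, (Finset.mem_filter.1 hX).2, h⟩)
      simp [this]
  · exact pow_le_pow_left₀ (norm_nonneg _) (ho.norm_le (Finset.mem_filter.1 hX).2.1) 2

end ChernoffBounds

/-! ### The main theorem. -/

theorem mainTheorem5 :
    ∃ C : ℝ, 0 < C ∧
      ∀ (N d k n : ℕ) (g : ℝ), 1 ≤ N → 1 ≤ k → 1 ≤ n → 0 < g →
      ∀ (ρ : SpinOp N d), IsProductState ρ →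
      ∀ (A : SpinOp N d) (Ac : Fin n → SpinOp N d) (a : Fin n → Finset (Fin N) → SpinOp N d),
        A = (1 / (n : ℝ)) • ∑ j, Ac j →
        (∀ j, IsLocalSum (a j) (Ac j)) →
        (∀ j, IsKLocal k (a j)) →
        (∀ j, IsGExtensive g (a j)) →
        (∀ j, IsNonOverlapping (a j)) →
        (∀ j, (Ac j).IsHermitian) →
        (∀ j, (ρ * Ac j).trace = 0) →
        ((∀ j, (numTerms (a j) : ℝ) ≤ N / k) →
          ChernoffBounds A ρ (2 * g * k) (chernoffConst C g k n)) ∧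
        ChernoffBounds A ρ (2 * g * k) (chernoffConst (k * C) g k n) := by
  -- With `S = g ^ 2 * N / k` as the bound on the sums of squares, `16 * S` equals `2 * g ^ 2 * C /
  -- k * N` for `C = 8`. Without the count of terms `S` is `g ^ 2 * N`, hence the extra factor `k`.
  refine ⟨8, by norm_num, ?_⟩
  intro N d k n g hN hk hn hg ρ hρ A Ac a hA ha hkl hga hd hAc h0
  have hk0 : (0 : ℝ) < k := by exact_mod_cast hk
  have hAc' : ∀ j, IsSelfAdjoint (Ac j) := fun j => hAc j
  have h0' : ∀ j, stateExpect ρ (Ac j) = 0 := fun j => by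
    rw [stateExpect_apply, Matrix.trace_mul_comm, h0 j, Complex.zero_re]
  have hAs : IsSelfAdjoint A := by
    rw [hA]
    exact (IsSelfAdjoint.all (1 / (n : ℝ))).smul (isSelfAdjoint_sum _ fun j _ => hAc' j)
  have main : ∀ C : ℝ, 0 < C →
      (∀ j, ∑ X : Finset (Fin N) with X.Nonempty, ‖a j X‖ ^ 2 ≤ g ^ 2 * C / (8 * k) * N) →
      ChernoffBounds A ρ (2 * g * k) (chernoffConst C g k n) := by
    intro C hC hS
    have hK := chernoffConst_eq C g k n
    refine ChernoffBounds.of_exp_le hN hρ.isDensityMatrix hAs (by positivity)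
      (by rw [hK]; positivity) fun τ hτ => ?_
    rw [hA]
    refine (stateExpect_exp_average_le hn hg hρ ha hkl hga hd hAc' h0' hS ?_).trans_eq ?_
    · rw [le_div_iff₀ (by positivity)] at hτ
      linarith
    · rw [hK]
      congr 1
      field_simp
      ring
  refine ⟨fun hnum => main 8 (by norm_num) fun j => ?_, main (k * 8) (by positivity) fun j => ?_⟩
  · refine (hga j).sum_sq_le_numTerms.trans ?_
    refine (mul_le_mul_of_nonneg_right (hnum j) (sq_nonneg g)).trans_eq ?_
    field_simp
  · refine ((hga j).sum_sq_le hg.le).trans_eq ?_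
    field_simp
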